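/- Let $\kappa$ be an uncountable cardinal with $\kappa^{<\kappa}=\kappa$, where $\kappa^{<\kappa}$ also denotes the set of all sequences of elements of $\kappa$ of length $\alpha<\kappa$. Let $\tau$ be a relational signature of size at most $\kappa$ in which each $R\in\tau$ has a finite arity $a(R)$, and let $X_\tau=\prod_{R\in\tau}2^{\kappa^{a(R)}}$ be the (generalized) logic space. Here $2^{\kappa^n}$ has the topology given by the basic open sets $U(s)=\{f: s\subseteq f\}$ for partial functions $s:\kappa^n\rightharpoonup 2$ of size less than $\kappa$, and $X_\tau$ has the product topology, with basic open sets given by restricting finitely many coordinates to basic open sets of the factors. The $\kappa$-Borel subsets of $X_\tau$ are those generated from the basic open sets by complements and by unions and intersections of length $\kappa$. Let $S_\kappa$ be the group of permutations of $\kappa$, with the subspace topology from $\kappa^\kappa$, whose basic open sets are the sets $\{f: s\subseteq f\}$ for partial functions $s:\kappa\rightharpoonup\kappa$ of size less than $\kappa$. It acts on $X_\tau$ by letting $g(x)$ be the structure for which $g$ is an isomorphism from $x$ onto $g(x)$, i.e. $g(x)(R)(t)=x(R)(g^{-1}\circ t)$. A set $A\subseteq X_\tau$ is $G$-invariant if $g(A)=A$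 for all $g\in G$. Let $G$ be a closed subgroup of $S_\kappa$ which is $\kappa$-Baire, i.e. in the subspace $G$ the intersection of every sequence of length $\kappa$ of open dense sets is dense. Let $\mathcal F$ be the family of all orbits $\mathrm{Orb}_G(s)=\{g\circ s: g\in G\}$ for $s\in\kappa^{<\kappa}$. Each orbit is a relation on $\kappa$ whose arity is the length of $s$. Let $\mathscr L_{\kappa^+\kappa}(\mathcal F)$ be the logic $\mathscr L_{\kappa^+\kappa}$ in the signature $\tau$ (conjunctions and disjunctions of at most $\kappa$ formulas, quantification over fewer than $\kappa$ variables at once) with an additional symbol for each relation in $\mathcal F$, whose interpretation is fixed as this relation. Then a subset $A$ of $X_\tau$ is $\kappa$-Borel and $G$-invariant if and only if it is definable in $\mathscr L_{\kappa^+\kappa}(\mathcal F)$, i.e. there is a sentence $\varphi$ of $\mathscr L_{\kappa^+\kappa}(\mathcal F)$ such that for all $M\in X_\tau$, $M\in A$ if and only if $M\models\varphi$. -/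

import Mathlib

universe u v

open scoped Topology Cardinal

namespace KappaLogic

/-- The cardinal `κ` as a set: the well-ordered set of all ordinals below `κ`. Its elements
serve both as the points of structures of size `κ` and as the ordinals `α < κ`, and
`Set.Iio α` is the ordinal `α` as a set. -/
abbrev Pt (κ : Cardinal.{u}) : Type u := κ.ord.ToType

/-- The set `κ^{<κ}` of all sequences of elements of `κ` of some length `α < κ`. -/
abbrev Seq (κ : Cardinal.{u}) : Type u := Σ α : Pt κ, (Set.Iio α → Pt κ)

/-! ### Spaces of functions and the permutation group of `κ` -/

/-- The set `U(s)` of all functions `A → B` that extend the partial function `s` with domain `D`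
and values `s t` for `t ∈ D`. -/
def cylinder {A : Type u} {B : Type v} (D : Set A) (s : A → B) : Set (A → B) :=
  {f | ∀ t ∈ D, f t = s t}

/-- The basic open sets of the function space `B^A`: the sets `U(s)` for partial functions `s`
of size less than `κ`. -/
def funBasic (κ : Cardinal.{u}) (A : Type u) (B : Type v) : Set (Set (A → B)) :=
  {U | ∃ (D : Set A) (s : A → B), #D < κ ∧ U = cylinder D s}

/-- The topology on `B^A` given by the basic open sets `U(s)` for partial functions `s` of size
less than `κ`. -/
@[reducible] def funTopology (κ : Cardinal.{u}) (A : Type u) (B : Type v) : TopologicalSpace (A → B) :=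
  TopologicalSpace.generateFrom (funBasic κ A B)

/-- The topology of `S_κ`, the permutation group of `κ`, as a subspace of `κ^κ`. -/
@[reducible] def permTopology (κ : Cardinal.{u}) : TopologicalSpace (Equiv.Perm (Pt κ)) :=
  (funTopology κ (Pt κ) (Pt κ)).induced (fun g => (g : Pt κ → Pt κ))

/-- A topological space is `κ`-Baire if the intersection of every sequence of length `κ` of open
dense sets is dense. -/
def IsKappaBaire (κ : Cardinal.{u}) (X : Type u) [TopologicalSpace X] : Prop :=
  ∀ U : Pt κ → Set X, (∀ i, IsOpen (U i)) → (∀ i, Dense (U i)) → Dense (⋂ i, U i)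

/-- A set of permutations of `κ` is `κ`-Baire as a subspace of `S_κ`. -/
def IsKappaBaireSubset (κ : Cardinal.{u}) (S : Set (Equiv.Perm (Pt κ))) : Prop :=
  @IsKappaBaire κ S ((permTopology κ).induced Subtype.val)

/-! ### The logic space -/

/-- The logic space `X_τ = ∏_{R ∈ τ} 2^(κ^{a(R)})` of the relational signature `τ` with arities
`a(R)`. -/
abbrev LogicSpace (κ : Cardinal.{u}) {τ : Type u} (a : τ → ℕ) : Type u :=
  (R : τ) → (Fin (a R) → Pt κ) → Bool

/-- The basic open sets of the product topology on `X_τ`: finitely many coordinates are restricted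
to basic open sets of the factors. -/
def logicBasic (κ : Cardinal.{u}) {τ : Type u} (a : τ → ℕ) : Set (Set (LogicSpace κ a)) :=
  {W | ∃ (T : Finset τ) (U : (R : τ) → Set ((Fin (a R) → Pt κ) → Bool)),
    (∀ R ∈ T, U R ∈ funBasic κ (Fin (a R) → Pt κ) Bool) ∧ W = {x | ∀ R ∈ T, x R ∈ U R}}

/-- The `κ`-Borel subsets of `X_τ`: generated from the basic open sets by complements and by
unions and intersections of length `κ`. -/
inductive IsKappaBorel (κ : Cardinal.{u}) {τ : Type u} (a : τ → ℕ) : Set (LogicSpace κ a) → Prop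
  | basic (W : Set (LogicSpace κ a)) (hW : W ∈ logicBasic κ a) : IsKappaBorel κ a W
  | compl (A : Set (LogicSpace κ a)) (hA : IsKappaBorel κ a A) : IsKappaBorel κ a Aᶜ
  | iUnion (A : Pt κ → Set (LogicSpace κ a)) (hA : ∀ i, IsKappaBorel κ a (A i)) :
      IsKappaBorel κ a (⋃ i, A i)
  | iInter (A : Pt κ → Set (LogicSpace κ a)) (hA : ∀ i, IsKappaBorel κ a (A i)) :
      IsKappaBorel κ a (⋂ i, A i)

/-- The action of `S_κ` on `X_τ`: `g` is an isomorphism from `x` onto `g(x)`. -/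
def permAct {κ : Cardinal.{u}} {τ : Type u} {a : τ → ℕ} (g : Equiv.Perm (Pt κ))
    (x : LogicSpace κ a) : LogicSpace κ a :=
  fun R t => x R (fun i => g⁻¹ (t i))

/-- `A ⊆ X_τ` is `G`-invariant: `g(A) = A` for all `g ∈ G`. -/
def IsInvariant {κ : Cardinal.{u}} {τ : Type u} {a : τ → ℕ} (G : Subgroup (Equiv.Perm (Pt κ)))
    (A : Set (LogicSpace κ a)) : Prop :=
  ∀ g ∈ G, permAct g '' A = A

/-! ### The logic `L_{κ⁺κ}(F)` -/

/-- A family of relations on `κ`, each of some arity below `κ`. -/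
structure RelFamily (κ : Cardinal.{u}) where
  /-- the index set -/
  Index : Type u
  /-- the arity of each relation, an ordinal below `κ` -/
  arity : Index → Pt κ
  /-- the relations -/
  rel : (i : Index) → Set (Set.Iio (arity i) → Pt κ)

/-- The `G`-orbit of a sequence in `κ^{<κ}`. -/
def orbit {κ : Cardinal.{u}} (G : Subgroup (Equiv.Perm (Pt κ))) (s : Seq κ) :
    Set (Set.Iio s.1 → Pt κ) :=
  {b | ∃ g ∈ G, b = fun i => g (s.2 i)}

/-- The family of all `G`-orbits of elements of `κ^{<κ}`. -/
abbrev orbitFamily {κ : Cardinal.{u}} (G : Subgroup (Equiv.Perm (Pt κ))) : RelFamily κ where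
  Index := Seq κ
  arity := fun s => s.1
  rel := fun s => orbit G s

/-- The variables of `L_{κ⁺κ}`: one for each ordinal below `κ⁺`. -/
abbrev Var (κ : Cardinal.{u}) : Type u := (Order.succ κ).ord.ToType

/-- The formulas of `L_{κ⁺κ}(F)` in the signature `τ`: equality, the relations of `τ`, a symbol for
each relation of `F`, negation, conjunctions of at most `κ` formulas and universal quantification
over sets of fewer than `κ` variables. Disjunctions and existential quantifiers are the usual
abbreviations. -/
inductive Formula (κ : Cardinal.{u}) {τ : Type u} (a : τ → ℕ) (F : RelFamily κ) : Type u
  | eq (x y : Var κ) : Formula κ a F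
  | rel (R : τ) (t : Fin (a R) → Var κ) : Formula κ a F
  | fixed (i : F.Index) (t : Set.Iio (F.arity i) → Var κ) : Formula κ a F
  | neg (φ : Formula κ a F) : Formula κ a F
  | conj (I : Set (Pt κ)) (φ : I → Formula κ a F) : Formula κ a F
  | all (V : Set (Var κ)) (hV : #V < κ) (φ : Formula κ a F) : Formula κ a F

namespace Formula

variable {κ : Cardinal.{u}} {τ : Type u} {a : τ → ℕ} {F : RelFamily κ}

/-- The free variables of a formula. -/
def freeVars : Formula κ a F → Set (Var κ)
  | eq x y => {x, y}
  | rel _ t => Set.range t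
  | fixed _ t => Set.range t
  | neg φ => φ.freeVars
  | conj _ φ => ⋃ i, (φ i).freeVars
  | all V _ φ => φ.freeVars \ V

/-- Satisfaction of a formula in the structure `M ∈ X_τ` under an assignment of the variables; the
symbols of `F` are interpreted as the relations of `F`. -/
def Sat (M : LogicSpace κ a) : Formula κ a F → (Var κ → Pt κ) → Prop
  | eq x y, v => v x = v y
  | rel R t, v => M R (fun i => v (t i)) = true
  | fixed i t, v => (fun j => v (t j)) ∈ F.rel i
  | neg φ, v => ¬ Sat M φ v
  | conj _ φ, v => ∀ i, Sat M (φ i) v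
  | all V _ φ, v => ∀ w : Var κ → Pt κ, (∀ x, x ∉ V → w x = v x) → Sat M φ w

end Formula

/-- `A ⊆ X_τ` is definable in `L_{κ⁺κ}(F)`: for some sentence `φ` (a formula without free
variables, so that the assignment does not matter), `M ∈ A` if and only if `M ⊨ φ`. -/
def IsDefinable {κ : Cardinal.{u}} {τ : Type u} {a : τ → ℕ} (F : RelFamily κ)
    (A : Set (LogicSpace κ a)) : Prop :=
  ∃ φ : Formula κ a F, φ.freeVars = ∅ ∧ ∀ M : LogicSpace κ a, M ∈ A ↔ ∀ v, φ.Sat M v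

end KappaLogic

/-! Definable sets are Borel and invariant by induction on formulas, carried out for all
assignments. A quantifier over fewer than `κ` variables becomes an intersection over at most `κ^{<κ}
= κ` assignments, and the symbols for orbits are harmless because elements of `G` preserve orbits.

The converse uses Vaught transforms. For a small set `D` and values `f` on `D`, let `N` be the set
of `g ∈ G` that agree with `f` on `D`, and ask whether `g⁻¹ M ∈ A` for all `g ∈ N` up to a
`κ`-meager set. By induction on Borel sets, this is expressed by a formula whose variable `x p`
denotes `g p`. Intersections become conjunctions. For complements, `A` is meager on `N` iff it is
comeager on no smaller nonempty basic open set (`HasDefinableTransforms.compl`); the orbit symbols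
let a formula range over these smaller sets (`exists_forall_extension`). This needs the Baire
property of the sets of translates, so the induction carries it along. Finally take `D = ∅`: for
invariant `A` the set of translates is all of `G` or empty, and `G` is not meager in itself. -/

namespace KappaLogic

/-! ### Cardinalities -/

section Card

variable {κ : Cardinal.{u}}

theorem mk_Pt (κ : Cardinal.{u}) : #(Pt κ) = κ := by
  rw [Cardinal.mk_toType, Cardinal.card_ord]

theorem nonempty_Pt (hκ : ℵ₀ ≤ κ) : Nonempty (Pt κ) := by
  rw [← Cardinal.mk_ne_zero_iff, mk_Pt]
  exact (Cardinal.aleph0_pos.trans_le hκ).ne'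

theorem mk_empty_lt (hκ : ℵ₀ ≤ κ) (B : Type u) : #(∅ : Set B) < κ := by
  rw [Cardinal.mk_eq_zero]
  exact Cardinal.aleph0_pos.trans_le hκ

theorem mk_Iio_lt (α : Pt κ) : #(Set.Iio α) < κ :=
  (Cardinal.mk_Iio_lt α (by rw [mk_Pt, Ordinal.type_toType])).trans_eq (mk_Pt κ)

theorem mk_fun_le (hpow : κ ^< κ = κ) {V : Type u} (hV : #V < κ) : #(V → Pt κ) ≤ κ := by
  rw [← Cardinal.power_def, mk_Pt]
  exact (Cardinal.le_powerlt κ hV).trans hpow.le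

theorem exists_Iio_equiv {V : Type u} (hV : #V < κ) :
    ∃ α : Pt κ, Nonempty (Set.Iio α ≃ V) := by
  have h : (#V).ord < Ordinal.type (α := Pt κ) (· < ·) := by
    rw [Ordinal.type_toType]
    exact Cardinal.ord_lt_ord.2 hV
  refine ⟨Ordinal.enum (α := Pt κ) (· < ·) ⟨_, h⟩, ?_⟩
  have h' := congrArg Ordinal.card (Ordinal.typein_enum (α := Pt κ) (· < ·) h)
  rw [Cardinal.card_ord] at h'
  exact Cardinal.eq.1 h'

/-- Replaces small domains by sequences, of which there are only `κ` many and each of which has its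
own orbit symbol. -/
theorem exists_seq_range {D : Set (Pt κ)} (hD : #D < κ) : ∃ s : Seq κ, Set.range s.2 = D := by
  obtain ⟨α, ⟨e⟩⟩ := exists_Iio_equiv hD
  refine ⟨⟨α, fun i => (e i : Pt κ)⟩, ?_⟩
  ext p
  exact ⟨fun ⟨i, hi⟩ => hi ▸ (e i).2, fun hp => ⟨e.symm ⟨p, hp⟩, by simp⟩⟩

theorem mk_sigma_Iio_le (hκ : ℵ₀ ≤ κ) {F : Pt κ → Type u} (hF : ∀ α, #(F α) ≤ κ) :
    #(Σ α, F α) ≤ κ := by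
  rw [Cardinal.mk_sigma]
  refine (Cardinal.sum_le_sum _ (fun _ => κ) hF).trans ?_
  rw [Cardinal.sum_const', mk_Pt, Cardinal.mul_eq_self hκ]

theorem mk_Seq_le (hκ : ℵ₀ ≤ κ) (hpow : κ ^< κ = κ) : #(Seq κ) ≤ κ :=
  mk_sigma_Iio_le hκ fun α => mk_fun_le hpow (mk_Iio_lt α)

theorem mk_seqPair_le (hκ : ℵ₀ ≤ κ) (hpow : κ ^< κ = κ) :
    #(Σ α : Pt κ, (Set.Iio α → Pt κ) × (Set.Iio α → Pt κ)) ≤ κ := by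
  refine mk_sigma_Iio_le hκ fun α => ?_
  have h := mk_fun_le hpow (mk_Iio_lt α)
  rw [← Cardinal.mul_def]
  exact (mul_le_mul' h h).trans (Cardinal.mul_eq_self hκ).le

theorem mk_union_lt (hκ : ℵ₀ ≤ κ) {B : Type u} {D E : Set B} (hD : #D < κ) (hE : #E < κ) :
    #(D ∪ E : Set B) < κ :=
  (Cardinal.mk_union_le D E).trans_lt (Cardinal.add_lt_of_lt hκ hD hE)

end Card

/-! ### Meager sets -/

section Meager

variable (κ : Cardinal.{u}) {X : Type u} [TopologicalSpace X]

/-- A set is `κ`-meager if it is disjoint from an intersection of `κ` many open dense sets. -/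
def IsKappaMeager (S : Set X) : Prop :=
  ∃ U : Pt κ → Set X, (∀ i, IsOpen (U i)) ∧ (∀ i, Dense (U i)) ∧ S ⊆ (⋂ i, U i)ᶜ

/-- A set has the local `κ`-Baire property if densely many open sets decide it modulo
`κ`-meager sets. -/
def HasKappaBaireProperty (S : Set X) : Prop :=
  ∀ N : Set X, IsOpen N → N.Nonempty →
    ∃ N' ⊆ N, IsOpen N' ∧ N'.Nonempty ∧ (IsKappaMeager κ (N' \ S) ∨ IsKappaMeager κ (N' ∩ S))

variable {κ}

theorem IsKappaMeager.mono {S T : Set X} (hT : IsKappaMeager κ T) (h : S ⊆ T) :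
    IsKappaMeager κ S := by
  obtain ⟨U, h1, h2, h3⟩ := hT
  exact ⟨U, h1, h2, h.trans h3⟩

theorem IsKappaMeager.empty : IsKappaMeager κ (∅ : Set X) :=
  ⟨fun _ => Set.univ, fun _ => isOpen_univ, fun _ => dense_univ, Set.empty_subset _⟩

theorem isKappaMeager_compl_of_dense (hκ : ℵ₀ ≤ κ) {U : Set X} (hU : IsOpen U) (hd : Dense U) :
    IsKappaMeager κ Uᶜ := by
  have := nonempty_Pt hκ
  exact ⟨fun _ => U, fun _ => hU, fun _ => hd, by rw [Set.iInter_const]⟩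

theorem IsKappaMeager.iUnion (hκ : ℵ₀ ≤ κ) {ι : Type u} (hι : #ι ≤ κ) {S : ι → Set X}
    (hS : ∀ i, IsKappaMeager κ (S i)) : IsKappaMeager κ (⋃ i, S i) := by
  choose U h1 h2 h3 using hS
  rcases isEmpty_or_nonempty ι with hne | hne
  · rw [Set.iUnion_of_empty]
    exact IsKappaMeager.empty
  have hc : #(ι × Pt κ) ≤ #(Pt κ) := by
    rw [← Cardinal.mul_def, mk_Pt]
    exact (mul_le_mul' hι le_rfl).trans (Cardinal.mul_eq_self hκ).le
  have := nonempty_Pt hκ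
  obtain ⟨e⟩ := hc
  -- Since `κ · κ = κ`, all the open dense sets can be listed, with repetitions, along `κ`.
  have hs : Function.Surjective (Function.invFun e) := Function.invFun_surjective e.injective
  refine ⟨fun j => U (Function.invFun e j).1 (Function.invFun e j).2, fun j => h1 _ _,
    fun j => h2 _ _, Set.iUnion_subset fun i x hx hmem => h3 i hx ?_⟩
  rw [Set.mem_iInter] at hmem ⊢
  intro j
  obtain ⟨k, hk⟩ := hs (i, j)
  simpa [hk] using hmem k

theorem IsKappaMeager.union (hκ : ℵ₀ ≤ κ) {S T : Set X} (hS : IsKappaMeager κ S)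
    (hT : IsKappaMeager κ T) : IsKappaMeager κ (S ∪ T) := by
  have hb : #(ULift.{u} Bool) ≤ κ := (Cardinal.lt_aleph0_of_finite _).le.trans hκ
  refine (IsKappaMeager.iUnion hκ hb (S := fun b => cond b.down S T) ?_).mono ?_
  · rintro ⟨_ | _⟩
    exacts [hT, hS]
  · rintro x (hx | hx)
    exacts [Set.mem_iUnion.2 ⟨⟨true⟩, hx⟩, Set.mem_iUnion.2 ⟨⟨false⟩, hx⟩]

theorem IsKappaBaire.not_isKappaMeager (hX : IsKappaBaire κ X) {N : Set X} (hN : IsOpen N)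
    (hne : N.Nonempty) : ¬ IsKappaMeager κ N := by
  rintro ⟨U, h1, h2, h3⟩
  obtain ⟨x, hx, hxU⟩ := (hX U h1 h2).inter_open_nonempty N hN hne
  exact h3 hx hxU

/-- A set that is `κ`-meager in densely many open subsets of an open set `N` is `κ`-meager in `N`,
in a space with a basis of size at most `κ`. -/
theorem isKappaMeager_inter_of_locally (hκ : ℵ₀ ≤ κ) {ι : Type u} (hι : #ι ≤ κ) {B : ι → Set X}
    (hB : TopologicalSpace.IsTopologicalBasis (Set.range B)) {N S : Set X}
    (hN : IsOpen N) (h : ∀ N' ⊆ N, IsOpen N' → N'.Nonempty →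
      ∃ N'' ⊆ N', IsOpen N'' ∧ N''.Nonempty ∧ IsKappaMeager κ (N'' ∩ S)) :
    IsKappaMeager κ (N ∩ S) := by
  let J := {i : ι // IsKappaMeager κ (B i ∩ S)}
  let W : Set X := ⋃ j : J, B j
  have hBo : ∀ i, IsOpen (B i) := fun i => hB.isOpen ⟨i, rfl⟩
  have hWo : IsOpen W := isOpen_iUnion fun j => hBo j
  have hJ : #J ≤ κ := (Cardinal.mk_subtype_le _).trans hι
  have hW : IsKappaMeager κ (W ∩ S) := by
    rw [Set.iUnion_inter]
    exact IsKappaMeager.iUnion hκ hJ fun j => j.2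
  have hVo : IsOpen (W ∪ interior Nᶜ) := hWo.union isOpen_interior
  have hVd : Dense (W ∪ interior Nᶜ) := by
    rw [dense_iff_inter_open]
    intro O hO hOne
    by_cases hON : (O ∩ interior Nᶜ).Nonempty
    · exact hON.mono (Set.inter_subset_inter_right _ Set.subset_union_right)
    have hNO : (O ∩ N).Nonempty := by
      by_contra hc
      obtain ⟨x, hx⟩ := hOne
      exact hON ⟨x, hx, interior_maximal (fun y hy hyN => hc ⟨y, hy, hyN⟩) hO hx⟩
    obtain ⟨N'', h1, h2, ⟨x, hx⟩, h3⟩ := h _ Set.inter_subset_right (hO.inter hN) hNO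
    obtain ⟨_, ⟨i, rfl⟩, hxi, hi⟩ := hB.exists_subset_of_mem_open hx h2
    exact ⟨x, (h1 hx).1, Or.inl (Set.mem_iUnion.2
      ⟨⟨i, h3.mono (Set.inter_subset_inter_left _ hi)⟩, hxi⟩)⟩
  refine (hW.union hκ (isKappaMeager_compl_of_dense hκ hVo hVd)).mono ?_
  rintro x ⟨hxN, hxS⟩
  by_cases hx : x ∈ W
  · exact Or.inl ⟨hx, hxS⟩
  · exact Or.inr fun hx' => hx'.elim hx fun h' => interior_subset h' hxN

theorem HasKappaBaireProperty.compl {S : Set X} (hS : HasKappaBaireProperty κ S) :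
    HasKappaBaireProperty κ Sᶜ := by
  intro N hN hne
  obtain ⟨N', h1, h2, h3, h4⟩ := hS N hN hne
  refine ⟨N', h1, h2, h3, ?_⟩
  rw [Set.sdiff_compl]
  exact h4.symm

theorem HasKappaBaireProperty.of_isClopen {S : Set X} (hS : IsClopen S) :
    HasKappaBaireProperty κ S := by
  intro N hN hne
  by_cases h : (N ∩ S).Nonempty
  · refine ⟨N ∩ S, Set.inter_subset_left, hN.inter hS.isOpen, h, Or.inl ?_⟩
    rw [Set.sdiff_eq_empty.2 Set.inter_subset_right]
    exact IsKappaMeager.empty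
  · refine ⟨N, subset_rfl, hN, hne, Or.inr ?_⟩
    rw [Set.not_nonempty_iff_eq_empty.1 h]
    exact IsKappaMeager.empty

/-- Either some `S j` is meager in a nonempty open part of `N`, and then so is the intersection, or
every `S j` is comeager in `N` by localization, and then so is the intersection. -/
theorem HasKappaBaireProperty.iInter (hκ : ℵ₀ ≤ κ) {ι : Type u} (hι : #ι ≤ κ) {B : ι → Set X}
    (hB : TopologicalSpace.IsTopologicalBasis (Set.range B)) {J : Type u} (hJ : #J ≤ κ)
    {S : J → Set X} (hS : ∀ j, HasKappaBaireProperty κ (S j)) :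
    HasKappaBaireProperty κ (⋂ j, S j) := by
  intro N hN hne
  by_cases h : ∃ j, ∃ N' ⊆ N, IsOpen N' ∧ N'.Nonempty ∧ IsKappaMeager κ (N' ∩ S j)
  · obtain ⟨j, N', h1, h2, h3, h4⟩ := h
    exact ⟨N', h1, h2, h3, Or.inr (h4.mono (Set.inter_subset_inter_right _ (Set.iInter_subset _ j)))⟩
  · push Not at h
    refine ⟨N, subset_rfl, hN, hne, Or.inl ?_⟩
    rw [Set.sdiff_iInter]
    refine IsKappaMeager.iUnion hκ hJ fun j => ?_
    refine isKappaMeager_inter_of_locally hκ hι hB hN fun N' h1 h2 h3 => ?_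
    obtain ⟨N'', k1, k2, k3, k4⟩ := hS j N' h2 h3
    exact ⟨N'', k1, k2, k3, k4.resolve_right (h j N'' (k1.trans h1) k2 k3)⟩

end Meager

/-! ### Formulas -/

namespace Formula

variable {κ : Cardinal.{u}} {τ : Type u} {a : τ → ℕ} {F : RelFamily κ}

theorem sat_congr (M : LogicSpace κ a) (φ : Formula κ a F) {v w : Var κ → Pt κ}
    (h : ∀ x ∈ φ.freeVars, v x = w x) : φ.Sat M v ↔ φ.Sat M w := by
  induction φ generalizing v w with
  | eq x y => simp [Sat, h x (by simp [freeVars]), h y (by simp [freeVars])]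
  | rel R t => simp only [Sat, h _ (Set.mem_range_self _)]
  | fixed i t => simp only [Sat, h _ (Set.mem_range_self _)]
  | neg φ ih => exact not_congr (ih h)
  | conj I φ ih =>
    exact forall_congr' fun i => ih i fun x hx => h x (Set.mem_iUnion.2 ⟨i, hx⟩)
  | all V hV φ ih =>
    classical
    have key : ∀ {v w : Var κ → Pt κ}, (∀ x ∈ (all V hV φ).freeVars, v x = w x) →
        (all V hV φ).Sat M v → (all V hV φ).Sat M w := by
      -- The assignment that is `u` on `V` and `v` elsewhere is a variant of `v` that agrees with
      -- `u` on the free variables of `φ`.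
      intro v w h hs u hu
      refine (ih fun x hx => ?_).1 (hs (fun x => if x ∈ V then u x else v x) fun x hx => if_neg hx)
      by_cases hxV : x ∈ V
      · simp [hxV]
      · simp [hxV, h x ⟨hx, hxV⟩, hu x hxV]
    exact ⟨key h, key fun x hx => (h x hx).symm⟩

theorem exists_conj {ι : Type u} (hι : #ι ≤ κ) (φ : ι → Formula κ a F) :
    ∃ ψ : Formula κ a F, ψ.freeVars = ⋃ i, (φ i).freeVars ∧
      ∀ M v, ψ.Sat M v ↔ ∀ i, (φ i).Sat M v := by
  rw [← mk_Pt κ] at hι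
  obtain ⟨e⟩ := hι
  let e' := Equiv.ofInjective e e.injective
  refine ⟨conj (Set.range e) fun i => φ (e'.symm i), ?_, fun M v => ?_⟩
  · exact e'.symm.surjective.iUnion_comp fun i => (φ i).freeVars
  · exact (e'.symm.surjective.forall (p := fun i => (φ i).Sat M v)).symm

theorem exists_imp (hκ : ℵ₀ ≤ κ) (φ ψ : Formula κ a F) :
    ∃ χ : Formula κ a F, χ.freeVars = φ.freeVars ∪ ψ.freeVars ∧
      ∀ M v, χ.Sat M v ↔ (φ.Sat M v → ψ.Sat M v) := by
  have hb : #(ULift.{u} Bool) ≤ κ := (Cardinal.lt_aleph0_of_finite _).le.trans hκ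
  obtain ⟨χ, h1, h2⟩ := exists_conj hb (fun b => cond b.down φ ψ.neg)
  refine ⟨χ.neg, ?_, fun M v => ?_⟩
  · rw [freeVars, h1]
    ext x
    simp [freeVars, or_comm]
  · rw [Sat, h2]
    simp [Sat, not_imp_not]

end Formula

/-! ### Definable sets are invariant and Borel -/

section Definable

variable {κ : Cardinal.{u}} {τ : Type u} {a : τ → ℕ}

theorem IsKappaBorel.univ (κ : Cardinal.{u}) (a : τ → ℕ) : IsKappaBorel κ a Set.univ :=
  .basic _ ⟨∅, fun _ => ∅, by simp, by simp⟩

theorem IsKappaBorel.iInter_of_le {ι : Type u} (hι : #ι ≤ κ) {A : ι → Set (LogicSpace κ a)}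
    (hA : ∀ i, IsKappaBorel κ a (A i)) : IsKappaBorel κ a (⋂ i, A i) := by
  rcases isEmpty_or_nonempty ι with hne | hne
  · rw [Set.iInter_of_empty]
    exact .univ κ a
  rw [← mk_Pt κ] at hι
  obtain ⟨e⟩ := hι
  rw [← (Function.invFun_surjective e.injective).iInter_comp A]
  exact .iInter _ fun _ => hA _

theorem isKappaBorel_rel (hκ : ℵ₀ ≤ κ) (R : τ) (p : Fin (a R) → Pt κ) :
    IsKappaBorel κ a {x | x R p = true} := by
  -- The equation `h` transports `p` to arity `a R'`, so the condition is vacuous when `R' ≠ R`.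
  refine .basic _ ⟨{R}, fun R' => {f | ∀ h : R' = R, f (h ▸ p) = true}, ?_, ?_⟩
  · simp only [Finset.mem_singleton, forall_eq]
    refine ⟨{p}, fun _ => true, ?_, ?_⟩
    · rw [Cardinal.mk_singleton]
      exact Cardinal.one_lt_aleph0.trans_le hκ
    · ext f
      simp [cylinder]
  · ext x
    refine ⟨fun h R' hR' e => ?_, fun h => h R (Finset.mem_singleton_self R) rfl⟩
    subst e
    exact h

theorem Formula.isKappaBorel_setOf_sat (hκ : ℵ₀ ≤ κ) (hpow : κ ^< κ = κ) {F : RelFamily κ}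
    (φ : Formula κ a F) (v : Var κ → Pt κ) : IsKappaBorel κ a {M | φ.Sat M v} := by
  have hconst : ∀ P : Prop, IsKappaBorel κ a {_M | P} := by
    intro P
    by_cases hP : P
    · simpa [hP] using IsKappaBorel.univ κ a
    · simpa [hP] using (IsKappaBorel.univ κ a).compl
  induction φ generalizing v with
  | eq x y => exact hconst _
  | rel R t => exact isKappaBorel_rel hκ R _
  | fixed i t => exact hconst _
  | neg φ ih => exact (ih v).compl
  | conj I φ ih =>
    have hI : #I ≤ κ := (Cardinal.mk_set_le I).trans (mk_Pt κ).le
    convert IsKappaBorel.iInter_of_le hI fun i => ih i v using 1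
    ext M
    simp [Sat]
  | all V hV φ ih =>
    classical
    convert IsKappaBorel.iInter_of_le (mk_fun_le hpow hV)
      (fun f : V → Pt κ => ih fun x => if h : x ∈ V then f ⟨x, h⟩ else v x) using 1
    ext M
    simp only [Sat, Set.mem_ofPred_eq, Set.mem_iInter]
    constructor
    · exact fun h f => h _ fun x hx => dif_neg hx
    · intro h w hw
      convert h (fun x => w x) using 2
      split_ifs with hx
      exacts [rfl, hw _ hx]

theorem permAct_mul (g h : Equiv.Perm (Pt κ)) (x : LogicSpace κ a) :
    permAct (g * h) x = permAct g (permAct h x) := by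
  funext R t
  simp [permAct, mul_inv_rev]

theorem permAct_one (x : LogicSpace κ a) : permAct 1 x = x := by
  funext R t
  simp [permAct]

/-- Orbits are preserved by `g` and `g⁻¹`, and composing with `g` permutes the assignments that a
quantifier ranges over. -/
theorem Formula.sat_permAct {G : Subgroup (Equiv.Perm (Pt κ))}
    (φ : Formula κ a (orbitFamily G)) {g : Equiv.Perm (Pt κ)} (hg : g ∈ G) (M : LogicSpace κ a)
    (v : Var κ → Pt κ) : φ.Sat (permAct g M) v ↔ φ.Sat M (fun x => g⁻¹ (v x)) := by
  induction φ generalizing v with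
  | eq x y => simp [Sat]
  | rel R t => simp [Sat, permAct]
  | fixed i t =>
    constructor
    · rintro ⟨h, hh, e⟩
      exact ⟨g⁻¹ * h, G.mul_mem (G.inv_mem hg) hh, by
        funext j; simpa using congrFun e j⟩
    · rintro ⟨h, hh, e⟩
      refine ⟨g * h, G.mul_mem hg hh, ?_⟩
      funext j
      have := congrFun e j
      simp only [Equiv.Perm.mul_apply]
      rw [← this]
      simp
  | neg φ ih => exact not_congr (ih v)
  | conj I φ ih => exact forall_congr' fun i => ih i v
  | all V hV φ ih =>
    simp only [Sat, ih]
    constructor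
    · intro h w hw
      convert h (fun x => g (w x)) (fun x hx => by simp [hw x hx]) using 2
      simp
    · exact fun h w hw => h _ fun x hx => by rw [hw x hx]

theorem isInvariant_of_forall {G : Subgroup (Equiv.Perm (Pt κ))} {A : Set (LogicSpace κ a)}
    (h : ∀ g ∈ G, ∀ M ∈ A, permAct g M ∈ A) : IsInvariant G A := by
  intro g hg
  refine Set.Subset.antisymm (Set.image_subset_iff.2 fun M hM => h g hg M hM) fun M hM => ?_
  exact ⟨permAct g⁻¹ M, h _ (G.inv_mem hg) M hM, by rw [← permAct_mul, mul_inv_cancel, permAct_one]⟩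

theorem IsInvariant.permAct_mem_iff {G : Subgroup (Equiv.Perm (Pt κ))}
    {A : Set (LogicSpace κ a)} (h : IsInvariant G A) {g : Equiv.Perm (Pt κ)} (hg : g ∈ G)
    {M : LogicSpace κ a} : permAct g M ∈ A ↔ M ∈ A := by
  have key : ∀ g ∈ G, ∀ M ∈ A, permAct g M ∈ A := fun g hg M hM =>
    (h g hg).subset (Set.mem_image_of_mem _ hM)
  refine ⟨fun hM => ?_, key g hg M⟩
  have := key _ (G.inv_mem hg) _ hM
  rwa [← permAct_mul, inv_mul_cancel, permAct_one] at this

theorem IsDefinable.isKappaBorel_and_isInvariant (hκ : ℵ₀ < κ) (hpow : κ ^< κ = κ)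
    {G : Subgroup (Equiv.Perm (Pt κ))} {A : Set (LogicSpace κ a)}
    (hA : IsDefinable (orbitFamily G) A) : IsKappaBorel κ a A ∧ IsInvariant G A := by
  obtain ⟨φ, hφ, hA⟩ := hA
  obtain ⟨p⟩ := nonempty_Pt hκ.le
  have hA' : ∀ M v, M ∈ A ↔ φ.Sat M v := fun M v =>
    (hA M).trans ⟨fun h => h v, fun h w => (φ.sat_congr M (by simp [hφ])).1 h⟩
  constructor
  · convert φ.isKappaBorel_setOf_sat hκ.le hpow (fun _ => p) using 1
    ext M
    exact hA' M _
  · refine isInvariant_of_forall fun g hg M hM => ?_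
    rw [hA' _ fun _ => p, φ.sat_permAct hg]
    exact (hA' M _).1 hM

end Definable

/-! ### The topology of the group -/

section GroupTopology

variable {κ : Cardinal.{u}}

/-- The subspace topology of a set of permutations of `κ`. -/
@[reducible] def permSetTopology (S : Set (Equiv.Perm (Pt κ))) : TopologicalSpace S :=
  (permTopology κ).induced Subtype.val

attribute [local instance] permSetTopology

/-- The elements of `S` whose restriction to `D` agrees with `f`. -/
def agreeSet (S : Set (Equiv.Perm (Pt κ))) (D : Set (Pt κ)) (f : Pt κ → Pt κ) : Set S :=
  {g | ∀ p ∈ D, (g : Equiv.Perm (Pt κ)) p = f p}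

variable (S : Set (Equiv.Perm (Pt κ)))

theorem isOpen_agreeSet {D : Set (Pt κ)} (hD : #D < κ) (f : Pt κ → Pt κ) :
    IsOpen (agreeSet S D f) := by
  refine ⟨{g | (g : Pt κ → Pt κ) ∈ cylinder D f}, ⟨cylinder D f, ?_, rfl⟩, rfl⟩
  exact TopologicalSpace.isOpen_generateFrom_of_mem ⟨D, f, hD, rfl⟩

variable {S}

theorem exists_agreeSet_subset (hκ : ℵ₀ ≤ κ) {U : Set S} (hU : IsOpen U) {g : S} (hg : g ∈ U) :
    ∃ D : Set (Pt κ), #D < κ ∧ agreeSet S D (g : Equiv.Perm (Pt κ)) ⊆ U := by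
  obtain ⟨_, ⟨W, hW, rfl⟩, rfl⟩ := hU
  have key : ∀ {W : Set (Pt κ → Pt κ)}, IsOpen[funTopology κ (Pt κ) (Pt κ)] W → ∀ f ∈ W, ∃ D : Set (Pt κ), #D < κ ∧ cylinder D f ⊆ W := by
    intro W hW f hf
    induction hW with
    | basic W hW =>
      obtain ⟨D, s, hD, rfl⟩ := hW
      exact ⟨D, hD, fun h hh p hp => (hh p hp).trans (hf p hp)⟩
    | univ =>
      exact ⟨∅, mk_empty_lt hκ _, Set.subset_univ _⟩
    | inter U V _ _ ihU ihV =>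
      obtain ⟨D, hD, hDU⟩ := ihU hf.1
      obtain ⟨E, hE, hEV⟩ := ihV hf.2
      exact ⟨D ∪ E, mk_union_lt hκ hD hE, fun h hh =>
        ⟨hDU fun p hp => hh p (Or.inl hp), hEV fun p hp => hh p (Or.inr hp)⟩⟩
    | sUnion C _ ih =>
      obtain ⟨U, hU, hfU⟩ := hf
      obtain ⟨D, hD, hDU⟩ := ih U hU hfU
      exact ⟨D, hD, hDU.trans (Set.subset_sUnion_of_mem hU)⟩
  obtain ⟨D, hD, hDW⟩ := key hW _ hg
  exact ⟨D, hD, fun h hh => hDW hh⟩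

theorem exists_permSet_basis (hκ : ℵ₀ ≤ κ) (hpow : κ ^< κ = κ)
    (S : Set (Equiv.Perm (Pt κ))) :
    ∃ (ι : Type u) (B : ι → Set S), #ι ≤ κ ∧
      TopologicalSpace.IsTopologicalBasis (Set.range B) := by
  refine ⟨_, fun b : Σ α : Pt κ, (Set.Iio α → Pt κ) × (Set.Iio α → Pt κ) =>
    {g | ∀ i, (g : Equiv.Perm (Pt κ)) (b.2.1 i) = b.2.2 i}, mk_seqPair_le hκ hpow, ?_⟩
  refine TopologicalSpace.isTopologicalBasis_of_isOpen_of_nhds ?_ ?_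
  -- The values `f` may be inconsistent when `s` repeats a point, so openness is checked around each
  -- member.
  · rintro _ ⟨⟨α, s, f⟩, rfl⟩
    rw [isOpen_iff_forall_mem_open]
    intro g hg
    refine ⟨agreeSet S (Set.range s) (g : Equiv.Perm (Pt κ)), fun h hh i => ?_,
      isOpen_agreeSet S (Cardinal.mk_range_le.trans_lt (mk_Iio_lt α)) _, fun p _ => rfl⟩
    exact (hh _ ⟨i, rfl⟩).trans (hg i)
  · intro g U hg hU
    obtain ⟨D, hD, hDU⟩ := exists_agreeSet_subset hκ hU hg
    obtain ⟨⟨α, s⟩, rfl⟩ := exists_seq_range hD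
    refine ⟨_, ⟨⟨α, s, fun i => (g : Equiv.Perm (Pt κ)) (s i)⟩, rfl⟩, fun i => rfl, ?_⟩
    rintro h hh
    exact hDU (by rintro _ ⟨i, rfl⟩; exact hh i)

theorem isClopen_of_locally_determined {D : Set (Pt κ)} {T : Set S} (hD : #D < κ)
    (h : ∀ g ∈ T, ∀ g' : S, (∀ p ∈ D, (g : Equiv.Perm (Pt κ)) p = (g' : Equiv.Perm (Pt κ)) p) →
      g' ∈ T) : IsClopen T := by
  constructor
  · rw [← isOpen_compl_iff, isOpen_iff_forall_mem_open]
    exact fun g hg => ⟨agreeSet S D (g : Equiv.Perm (Pt κ)),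
      fun g' hg' hT => hg (h g' hT g hg'), isOpen_agreeSet S hD _, fun _ _ => rfl⟩
  · rw [isOpen_iff_forall_mem_open]
    exact fun g hg => ⟨agreeSet S D (g : Equiv.Perm (Pt κ)),
      fun g' hg' => h g hg g' fun p hp => (hg' p hp).symm, isOpen_agreeSet S hD _, fun _ _ => rfl⟩

end GroupTopology

/-! ### Vaught transforms -/

section Vaught

attribute [local instance] permSetTopology

variable {κ : Cardinal.{u}} {τ : Type u} {a : τ → ℕ}

/-- The elements `g` of `S` with `g⁻¹ M ∈ A`. -/
def translates (S : Set (Equiv.Perm (Pt κ))) (A : Set (LogicSpace κ a)) (M : LogicSpace κ a) :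
    Set S :=
  {g | permAct (g : Equiv.Perm (Pt κ))⁻¹ M ∈ A}

/-- `φ` defines the Vaught transform of `A` on the open sets given by partial functions with
domain `D`, where the variable `x p` stands for the image of `p`. -/
def DefinesTransform (G : Subgroup (Equiv.Perm (Pt κ))) (x : Pt κ → Var κ)
    (A : Set (LogicSpace κ a)) (D : Set (Pt κ)) (φ : Formula κ a (orbitFamily G)) : Prop :=
  φ.freeVars ⊆ x '' D ∧ ∀ M v, φ.Sat M v ↔
    IsKappaMeager κ (agreeSet (G : Set (Equiv.Perm (Pt κ))) D (v ∘ x) \ translates G A M)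

/-- `A` has definable Vaught transforms, and its translates have the `κ`-Baire property. -/
def HasDefinableTransforms (G : Subgroup (Equiv.Perm (Pt κ))) (x : Pt κ → Var κ)
    (A : Set (LogicSpace κ a)) : Prop :=
  (∀ M, HasKappaBaireProperty κ (translates (G : Set (Equiv.Perm (Pt κ))) A M)) ∧
    ∀ D : Set (Pt κ), #D < κ → ∃ φ, DefinesTransform G x A D φ

variable {G : Subgroup (Equiv.Perm (Pt κ))} {x : Pt κ → Var κ}

/-- Quantification over the extensions of a partial function to a larger domain `E`. -/
theorem exists_forall_extension (hκ : ℵ₀ ≤ κ) (hx : Function.Injective x) {D E : Set (Pt κ)}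
    (hE : #E < κ) (hDE : D ⊆ E) (ψ : Formula κ a (orbitFamily G)) (hψ : ψ.freeVars ⊆ x '' E) :
    ∃ φ : Formula κ a (orbitFamily G), φ.freeVars ⊆ x '' D ∧ ∀ M v, φ.Sat M v ↔
      ∀ g ∈ agreeSet (G : Set (Equiv.Perm (Pt κ))) D (v ∘ x), ∀ w : Var κ → Pt κ,
        (∀ p ∈ E, w (x p) = (g : Equiv.Perm (Pt κ)) p) → ψ.Sat M w := by
  obtain ⟨s, rfl⟩ := exists_seq_range hE
  obtain ⟨χ, h1, h2⟩ := Formula.exists_imp hκ (.fixed s fun i => x (s.2 i)) ψ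
  have hV : #(x '' (Set.range s.2 \ D)) < κ :=
    (Cardinal.mk_image_le.trans (Cardinal.mk_le_mk_of_subset Set.sdiff_subset)).trans_lt hE
  refine ⟨.all (x '' (Set.range s.2 \ D)) hV χ, ?_, fun M v => ?_⟩
  · rintro y ⟨hy, hyV⟩
    have hyE : y ∈ x '' Set.range s.2 := by
      rw [h1] at hy
      rcases hy with ⟨i, rfl⟩ | hy
      exacts [⟨_, ⟨i, rfl⟩, rfl⟩, hψ hy]
    obtain ⟨p, hp, rfl⟩ := hyE
    by_cases hpD : p ∈ D
    exacts [⟨p, hpD, rfl⟩, absurd ⟨p, ⟨hp, hpD⟩, rfl⟩ hyV]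
  · simp only [Formula.Sat, h2]
    constructor
    · intro h g hg w hw
      classical
      -- `w` is constrained only on `x '' E`; `w'` makes it a legitimate variant of `v` without
      -- changing the values there.
      let w' : Var κ → Pt κ := fun y => if y ∈ x '' (Set.range s.2 \ D) then w y else v y
      have hw' : ∀ p ∈ Set.range s.2, w' (x p) = (g : Equiv.Perm (Pt κ)) p := by
        intro p hp
        by_cases hpD : p ∈ D
        · have : x p ∉ x '' (Set.range s.2 \ D) := by
            rintro ⟨q, hq, e⟩
            exact hq.2 (hx e ▸ hpD)
          simp only [w', if_neg this]
          exact (hg p hpD).symm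
        · simp only [w', if_pos (Set.mem_image_of_mem x (show p ∈ Set.range s.2 \ D from ⟨hp, hpD⟩))]
          exact hw p hp
      have := h w' (fun y hy => if_neg hy) ⟨g, g.2, funext fun i => hw' _ ⟨i, rfl⟩⟩
      refine (ψ.sat_congr M fun y hy => ?_).1 this
      obtain ⟨p, hp, rfl⟩ := hψ hy
      rw [hw' p hp, hw p hp]
    · rintro h w hw ⟨g, hg, e⟩
      refine h ⟨g, hg⟩ (fun p hp => ?_) w ?_
      · obtain ⟨i, rfl⟩ := hDE hp
        rw [Function.comp_apply, ← hw]
        · exact (congrFun e i).symm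
        · rintro ⟨q, hq, e⟩
          exact hq.2 (hx e ▸ hp)
      · rintro _ ⟨i, rfl⟩
        exact congrFun e i

theorem agreeSet_congr (S : Set (Equiv.Perm (Pt κ))) {D : Set (Pt κ)} {f f' : Pt κ → Pt κ}
    (h : ∀ p ∈ D, f p = f' p) : agreeSet S D f = agreeSet S D f' := by
  ext g
  exact forall₂_congr fun p hp => by rw [h p hp]

/-- Whether `g⁻¹ M` satisfies `R` at `p` depends only on `g` on the finite range of `p`, so the
translates form a clopen set. A nonempty open set is not meager, so "up to a meager set" here means
"without exception". -/
theorem hasDefinableTransforms_rel (hκ : ℵ₀ ≤ κ) (hx : Function.Injective x)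
    (hBaire : IsKappaBaireSubset κ (G : Set (Equiv.Perm (Pt κ)))) (R : τ)
    (p : Fin (a R) → Pt κ) : HasDefinableTransforms G x {y : LogicSpace κ a | y R p = true} := by
  have hfin : #(Set.range p) < κ := (Cardinal.lt_aleph0_of_finite _).trans_le hκ
  have hT : ∀ M : LogicSpace κ a, IsClopen (translates (G : Set (Equiv.Perm (Pt κ)))
      {y : LogicSpace κ a | y R p = true} M) := by
    intro M
    refine isClopen_of_locally_determined hfin fun g hg g' h => ?_
    have : (fun i => (g' : Equiv.Perm (Pt κ)) (p i)) = fun i => (g : Equiv.Perm (Pt κ)) (p i) :=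
      funext fun i => (h _ ⟨i, rfl⟩).symm
    simpa [translates, permAct, this] using hg
  refine ⟨fun M => .of_isClopen (hT M), fun D hD => ?_⟩
  obtain ⟨φ, h1, h2⟩ := exists_forall_extension (a := a) (G := G) hκ hx (mk_union_lt hκ hD hfin)
    Set.subset_union_left (.rel R fun i => x (p i))
    (Set.range_subset_iff.2 fun i => ⟨p i, Or.inr ⟨i, rfl⟩, rfl⟩)
  refine ⟨φ, h1, fun M v => (h2 M v).trans ⟨fun h => ?_, fun h g hg w hw => ?_⟩⟩
  · convert IsKappaMeager.empty
    refine Set.sdiff_eq_empty.2 fun g hg => ?_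
    have := nonempty_Pt hκ
    have hi : ∀ q, Function.invFun x (x q) = q := Function.leftInverse_invFun hx
    have := h g hg (fun y => (g : Equiv.Perm (Pt κ)) (Function.invFun x y))
      (fun q _ => by simp only [hi])
    simpa [translates, permAct, Formula.Sat, hi] using this
  · by_contra hc
    refine IsKappaBaire.not_isKappaMeager hBaire
      ((isOpen_agreeSet _ hD (v ∘ x)).sdiff (hT M).isClosed) ⟨g, hg, fun hg' => hc ?_⟩ h
    have : (fun i => w (x (p i))) = fun i => (g : Equiv.Perm (Pt κ)) (p i) :=
      funext fun i => hw _ (Or.inr ⟨i, rfl⟩)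
    simpa [translates, permAct, Formula.Sat, this] using hg'

theorem HasDefinableTransforms.iInter (hκ : ℵ₀ ≤ κ) (hpow : κ ^< κ = κ) {ι : Type u}
    (hι : #ι ≤ κ) {A : ι → Set (LogicSpace κ a)} (hA : ∀ i, HasDefinableTransforms G x (A i)) :
    HasDefinableTransforms G x (⋂ i, A i) := by
  have hT : ∀ M, translates (G : Set (Equiv.Perm (Pt κ))) (⋂ i, A i) M =
      ⋂ i, translates (G : Set (Equiv.Perm (Pt κ))) (A i) M := by
    intro M
    ext g
    simp [translates]
  obtain ⟨J, B, hJ, hB⟩ := exists_permSet_basis hκ hpow (G : Set (Equiv.Perm (Pt κ)))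
  refine ⟨fun M => ?_, fun D hD => ?_⟩
  · rw [hT]
    exact .iInter hκ hJ hB hι fun i => (hA i).1 M
  · choose φ h1 h2 using fun i => (hA i).2 D hD
    obtain ⟨ψ, k1, k2⟩ := Formula.exists_conj hι φ
    refine ⟨ψ, k1 ▸ Set.iUnion_subset h1, fun M v => ?_⟩
    rw [k2, hT, Set.sdiff_iInter]
    simp only [h2]
    exact ⟨fun h => .iUnion hκ hι h, fun h i => h.mono (Set.subset_iUnion_of_subset i subset_rfl)⟩

theorem HasDefinableTransforms.compl (hκ : ℵ₀ ≤ κ) (hpow : κ ^< κ = κ)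
    (hx : Function.Injective x) (hBaire : IsKappaBaireSubset κ (G : Set (Equiv.Perm (Pt κ))))
    {A : Set (LogicSpace κ a)} (hA : HasDefinableTransforms G x A) :
    HasDefinableTransforms G x Aᶜ := by
  refine ⟨fun M => (hA.1 M).compl, fun D hD => ?_⟩
  -- The sets `D ∪ range s` run through all small domains extending `D`, and there are at most `κ`
  -- indices `s`.
  have hE : ∀ s : Seq κ, #(D ∪ Set.range s.2 : Set (Pt κ)) < κ := fun s =>
    mk_union_lt hκ hD (Cardinal.mk_range_le.trans_lt (mk_Iio_lt s.1))
  choose φ h1 h2 using fun s => hA.2 _ (hE s)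
  choose ψ k1 k2 using fun s => exists_forall_extension hκ hx (hE s) Set.subset_union_left
    (φ s).neg (h1 s)
  obtain ⟨χ, l1, l2⟩ := Formula.exists_conj (mk_Seq_le hκ hpow) ψ
  refine ⟨χ, l1 ▸ Set.iUnion_subset k1, fun M v => ?_⟩
  have hT : translates (G : Set (Equiv.Perm (Pt κ))) Aᶜ M =
    (translates (G : Set (Equiv.Perm (Pt κ))) A M)ᶜ := rfl
  rw [l2, hT, Set.sdiff_compl]
  simp only [k2, Formula.Sat, h2]
  constructor
  · intro h
    obtain ⟨J, B, hJ, hB⟩ := exists_permSet_basis hκ hpow (G : Set (Equiv.Perm (Pt κ)))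
    refine isKappaMeager_inter_of_locally hκ hJ hB (isOpen_agreeSet _ hD _) ?_
    intro N' hN' hN'o hne
    obtain ⟨N, n1, n2, ⟨g, hg⟩, n4⟩ := hA.1 M N' hN'o hne
    -- If `A` were comeager on `N`, it would be comeager on a basic neighbourhood of `g` inside `N`,
    -- which the formula for its domain excludes.
    refine ⟨N, n1, n2, ⟨g, hg⟩, n4.resolve_left fun hm => ?_⟩
    obtain ⟨E, hEc, hEN⟩ := exists_agreeSet_subset hκ n2 hg
    obtain ⟨s, rfl⟩ := exists_seq_range hEc
    have := nonempty_Pt hκ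
    have hi : ∀ q, Function.invFun x (x q) = q := Function.leftInverse_invFun hx
    refine h s g (hN' (n1 hg)) (fun y => (g : Equiv.Perm (Pt κ)) (Function.invFun x y))
      (fun q _ => by simp only [hi]) (hm.mono (Set.sdiff_subset_sdiff_left fun g' hg' => hEN ?_))
    intro p hp
    simpa [hi] using hg' p (Or.inr hp)
  · intro h s g hg w hw hm
    -- If `A` were comeager on the smaller basic set and meager on the larger one, the smaller set
    -- would be a nonempty meager open set.
    refine IsKappaBaire.not_isKappaMeager hBaire
      (isOpen_agreeSet _ (hE s) (w ∘ x)) ⟨g, fun p hp => (hw p hp).symm⟩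
      ((hm.union hκ h).mono fun g' hg' => ?_)
    by_cases hgA : g' ∈ translates (G : Set (Equiv.Perm (Pt κ))) A M
    · refine Or.inr ⟨fun p hp => ?_, hgA⟩
      rw [hg' p (Or.inl hp), Function.comp_apply, hw p (Or.inl hp), hg p hp]
    · exact Or.inl ⟨hg', hgA⟩

theorem IsKappaBorel.hasDefinableTransforms (hκ : ℵ₀ ≤ κ) (hpow : κ ^< κ = κ)
    (hx : Function.Injective x) (hBaire : IsKappaBaireSubset κ (G : Set (Equiv.Perm (Pt κ))))
    {A : Set (LogicSpace κ a)} (hA : IsKappaBorel κ a A) : HasDefinableTransforms G x A := by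
  have hcompl : ∀ {B : Set (LogicSpace κ a)}, HasDefinableTransforms G x B →
      HasDefinableTransforms G x Bᶜ := fun h => h.compl hκ hpow hx hBaire
  induction hA with
  | basic W hW =>
    obtain ⟨T, U, hU, rfl⟩ := hW
    have hU' : ∀ R : T, HasDefinableTransforms G x {y : LogicSpace κ a | y R ∈ U R} := by
      intro R
      obtain ⟨D, s, hD, hs⟩ := hU R R.2
      -- A basic open set involves fewer than `κ` values, each given by an atomic condition or its
      -- complement.
      have : {y : LogicSpace κ a | y R ∈ U R} = ⋂ p : D, {y | y R p = s p} := by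
        ext y
        simp [hs, cylinder]
      rw [this]
      refine .iInter hκ hpow hD.le fun p => ?_
      have hr := hasDefinableTransforms_rel hκ hx hBaire (R : τ) (p : Fin (a R) → Pt κ)
      cases s p with
      | true => exact hr
      | false =>
        convert hcompl hr using 1
        ext y
        simp
    have : {y : LogicSpace κ a | ∀ R ∈ T, y R ∈ U R} = ⋂ R : T, {y | y R ∈ U R} := by
      ext y
      simp
    rw [this]
    exact .iInter hκ hpow ((Cardinal.lt_aleph0_of_finite T).le.trans hκ) hU'
  | compl A _ ih => exact hcompl ih
  | iUnion A _ ih =>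
    rw [← compl_compl (⋃ i, A i), Set.compl_iUnion]
    exact hcompl (.iInter hκ hpow (mk_Pt κ).le fun i => hcompl (ih i))
  | iInter A _ ih => exact .iInter hκ hpow (mk_Pt κ).le ih

theorem IsKappaBorel.isDefinable (hκ : ℵ₀ < κ) (hpow : κ ^< κ = κ)
    (hBaire : IsKappaBaireSubset κ (G : Set (Equiv.Perm (Pt κ))))
    {A : Set (LogicSpace κ a)} (hA : IsKappaBorel κ a A) (hG : IsInvariant G A) :
    IsDefinable (orbitFamily G) A := by
  have hle : #(Pt κ) ≤ #(Var κ) := by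
    rw [mk_Pt, Cardinal.mk_toType, Cardinal.card_ord]
    exact Order.le_succ κ
  obtain ⟨x⟩ := hle
  have h0 := mk_empty_lt hκ.le (Pt κ)
  obtain ⟨φ, h1, h2⟩ := (hA.hasDefinableTransforms hκ.le hpow x.injective hBaire).2 ∅ h0
  obtain ⟨p⟩ := nonempty_Pt hκ.le
  have hinv : ∀ M (g : (G : Set (Equiv.Perm (Pt κ)))),
      g ∈ translates (G : Set (Equiv.Perm (Pt κ))) A M ↔ M ∈ A := fun M g =>
    hG.permAct_mem_iff (G.inv_mem g.2)
  refine ⟨φ, by simpa using h1, fun M => ⟨fun hM v => ?_, fun h => ?_⟩⟩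
  · rw [h2]
    convert IsKappaMeager.empty
    exact Set.sdiff_eq_empty.2 fun g _ => (hinv M g).2 hM
  · by_contra hM
    refine IsKappaBaire.not_isKappaMeager hBaire (isOpen_agreeSet _ h0 fun _ => p)
      ⟨⟨1, G.one_mem⟩, fun q hq => hq.elim⟩ (((h2 M fun _ => p).1 (h _)).mono fun g hg => ?_)
    exact ⟨hg, fun hg' => hM ((hinv M g).1 hg')⟩

end Vaught

end KappaLogic

theorem proposition25 (κ : Cardinal.{u}) (hκ : ℵ₀ < κ)
    (hpow : κ ^< κ = κ)
    {τ : Type u} (hτ : #τ ≤ κ) (a : τ → ℕ)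
    (G : Subgroup (Equiv.Perm (KappaLogic.Pt κ)))
    (hclosed : IsClosed[KappaLogic.permTopology κ] (G : Set (Equiv.Perm (KappaLogic.Pt κ))))
    (hBaire : KappaLogic.IsKappaBaireSubset κ (G : Set (Equiv.Perm (KappaLogic.Pt κ))))
    (A : Set (KappaLogic.LogicSpace κ a)) :
    (KappaLogic.IsKappaBorel κ a A ∧ KappaLogic.IsInvariant G A) ↔
      KappaLogic.IsDefinable (KappaLogic.orbitFamily G) A :=
  ⟨fun h => h.1.isDefinable hκ hpow hBaire h.2,
    fun h => h.isKappaBorel_and_isInvariant hκ hpow⟩
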